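/- Let \(q\in\mathbb{C}\setminus\{0\}\) and \(c\in\mathbb{C}\) with \((q,c)\neq(1,0)\), and let the Hahn difference operator be \[ \mathcal{D}_{q,c}g(z)=\frac{g(qz+c)-g(z)}{(q-1)z+c},\qquad \mathcal{D}^{0}_{q,c}g=g,\qquad \mathcal{D}^{k}_{q,c}g=\mathcal{D}_{q,c}\bigl(\mathcal{D}^{k-1}_{q,c}g\bigr)\quad(k\ge 1). \] For a meromorphic function \(g\) on \(\mathbb{C}\), let \[ m(r,g)=\frac1{2\pi}\int_0^{2\pi}\log^+|g(re^{i\theta})|\,d\theta \] be its proximity function, let \(T(r,g)=m(r,g)+N(r,g)\) be its Nevanlinna characteristic, where \(N(r,g)\) is the integrated counting function of the poles of \(g\) with multiplicity, and let \[ \rho_{\log}(g)=\limsup_{r\to\infty}\frac{\log^+T(r,g)}{\log\log r} \] be its logarithmic order. Suppose that \(g\) is a non-constant meromorphic function on \(\mathbb{C}\) with \(\rho_{\log}(g)<\infty\), and let \(k\ge 0\) be an integer. Then for every \(\varepsilon>0\), \[ m\left(r,\frac{\mathcal{D}^{k}_{q,c}g}{g}\right)=O\bigl((\log r)^{\rho_{\log}(g)-1+\varepsilon}\bigr)\qquad(r\to\infty),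 \] that is, the bound holds for all sufficiently large \(r\), without an exceptional set; the implied constant and the threshold for \(r\) may depend on \(g,q,c,k,\varepsilon\). -/

import Mathlib

/-- The Hahn difference operator `D_{q,c} g (z) = (g (q z + c) - g z) / ((q - 1) z + c)`. -/
noncomputable def hahnDifference (q c : ℂ) (g : ℂ → ℂ) : ℂ → ℂ :=
  fun z => (g (q * z + c) - g z) / ((q - 1) * z + c)

/-- The logarithmic order `limsup_{r → ∞} log⁺ T(r, g) / log log r`, as an extended real number;
here `T(r, g)` is the Nevanlinna characteristic (proximity function plus integrated counting
function of the poles). -/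
noncomputable def logarithmicOrder (g : ℂ → ℂ) : EReal :=
  Filter.limsup
    (fun r : ℝ =>
      ((Real.posLog (ValueDistribution.characteristic g ⊤ r) / Real.log (Real.log r) : ℝ) : EReal))
    Filter.atTop

/-- A meromorphic function on `ℂ` is given by a function `ℂ → ℂ` up to its values on a closed
discrete set, so it is constant when it agrees with a constant off such a set. -/
def IsConstantMeromorphic (g : ℂ → ℂ) : Prop :=
  ∃ a : ℂ, g =ᶠ[Filter.codiscrete ℂ] fun _ => a

/-! Far from the origin `(q - 1) * z + c` is bounded away from 0, so the `k`-th Hahn difference is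
dominated by the values of `g` at the iterates of `z ↦ q * z + c`. These iterates are affine, so
everything reduces to the proximity of `g (a * z + b) / g z` (`isBigO_proximity_comp_affine_div`).
On the disk of radius `R = r ^ 2`, write `g` as a product over its zeros and poles times a zero-free
analytic `h`. Each zero or pole costs a bounded amount on average over `|z| = r`, uniformly in its
position, hence `O(n(R))` in all; the factor `h` is controlled by Poisson's formula and contributes
only `O((log r) ^ τ / r)`. Counting at radius `R ^ 2 = r ^ 4` gives `n(R) log R ≤ N(r ^ 4) = O((log
r) ^ τ)`, which saves one power of `log r`. Passing from `r` to `r ^ 4` multiplies `log r` only by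
4, so no growth lemma and no exceptional set is needed. -/

open Asymptotics Filter Metric Real MeromorphicOn Set ValueDistribution

/-! ### Circle averages and logarithmic distances under affine maps. -/

/-- Monotonicity of circle averages for functions that are comparable off a discrete set. -/
theorem circleAverage_mono_codiscreteWithin {c : ℂ} {R : ℝ} {f g : ℂ → ℝ}
    (hf : CircleIntegrable f c R) (hg : CircleIntegrable g c R) (hR : R ≠ 0)
    (h : f ≤ᶠ[codiscreteWithin (sphere c |R|)] g) :
    circleAverage f c R ≤ circleAverage g c R := by
  have hm : f =ᶠ[codiscreteWithin (sphere c |R|)] fun z ↦ min (f z) (g z) := by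
    filter_upwards [h] with z hz using (min_eq_left hz).symm
  rw [circleAverage_congr_codiscreteWithin hm hR]
  exact circleAverage_mono (hf.congr_codiscreteWithin hm) hg fun z _ ↦ min_le_right _ _

theorem eventually_ne_codiscreteWithin (U : Set ℂ) (u : ℂ) : ∀ᶠ z in codiscreteWithin U, z ≠ u := by
  change {z | z ≠ u} ∈ codiscreteWithin U
  rw [codiscreteWithin_iff_locallyEmptyComplementWithin]
  intro z _
  refine ⟨{u}ᶜ \ {z}, ?_, ?_⟩
  · by_cases h : z = u
    · subst h
      simpa [sdiff_self] using (self_mem_nhdsWithin : ({z}ᶜ : Set ℂ) ∈ nhdsWithin z {z}ᶜ)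
    · exact inter_mem (nhdsWithin_le_nhds (isOpen_compl_singleton.mem_nhds h)) self_mem_nhdsWithin
  · ext x
    simp
    tauto

theorem circleIntegrable_log_norm_sub_add (u : ℂ) {r : ℝ} (hr : 0 < r) :
    CircleIntegrable (fun z ↦ log (‖z - u‖ + r)) 0 r := by
  apply ContinuousOn.circleIntegrable'
  apply ContinuousOn.log (by fun_prop)
  intro z _
  positivity

/-- By Jensen the mean of `log ‖z - u‖` is `log (max r ‖u‖)`, while `‖z - u‖ + r ≤ ‖u‖ + 2 * r ≤ 3 *
max r ‖u‖` on the circle. -/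
theorem circleAverage_log_norm_sub_add_sub_log_norm_sub_le (u : ℂ) {r : ℝ} (hr : 0 < r) :
    circleAverage (fun z ↦ log (‖z - u‖ + r) - log ‖z - u‖) 0 r ≤ log 3 := by
  rw [circleAverage_fun_sub (circleIntegrable_log_norm_sub_add u hr)
    (circleIntegrable_log_norm_sub_const r),
    circleAverage_log_norm_sub_const_eq_log_radius_add_posLog hr.ne',
    posLog_eq_log_max_one (by positivity), zero_sub, norm_neg]
  have h₁ : circleAverage (fun z ↦ log (‖z - u‖ + r)) 0 r ≤ log (‖u‖ + 2 * r) := by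
    apply circleAverage_mono_on_of_le_circle (circleIntegrable_log_norm_sub_add u hr)
    intro z hz
    rw [mem_sphere_zero_iff_norm, abs_of_pos hr] at hz
    have := norm_sub_le z u
    apply log_le_log (by positivity)
    linarith
  have hm : 0 < max 1 (r⁻¹ * ‖u‖) := by positivity
  have h₂ : log (‖u‖ + 2 * r) ≤ log (3 * (r * max 1 (r⁻¹ * ‖u‖))) := by
    apply log_le_log (by positivity)
    have h₃ : r * 1 ≤ r * max 1 (r⁻¹ * ‖u‖) := by gcongr; exact le_max_left _ _
    have h₄ : r * (r⁻¹ * ‖u‖) ≤ r * max 1 (r⁻¹ * ‖u‖) := by gcongr; exact le_max_right _ _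
    rw [mul_inv_cancel_left₀ hr.ne'] at h₄
    linarith
  rw [log_mul (by norm_num) (by positivity), log_mul hr.ne' hm.ne'] at h₂
  linarith

theorem circleIntegrable_log_norm_affine_sub (a b u : ℂ) (r : ℝ) :
    CircleIntegrable (fun z ↦ log ‖a * z + b - u‖) 0 r :=
  MeromorphicOn.circleIntegrable_log_norm (fun _ _ ↦ by fun_prop)

/-- The logarithmic distances to a point `u` before and after an affine substitution differ, on
average over a circle, by an amount that depends neither on `u` nor on the circle. -/
theorem exists_circleAverage_abs_log_norm_affine_sub_le {a : ℂ} (ha : a ≠ 0) (b : ℂ) :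
    ∃ C : ℝ, 0 ≤ C ∧ ∀ u : ℂ, ∀ r : ℝ, 1 ≤ r →
      circleAverage (fun z ↦ |log ‖a * z + b - u‖ - log ‖z - u‖|) 0 r ≤ C := by
  set d : ℝ := ‖a - 1‖ + ‖b‖ with hd
  have hd0 : 0 ≤ d := by positivity
  have ha' : 0 < ‖a‖ := norm_pos_iff.2 ha
  set C₀ : ℝ := log (1 + d) + |log (‖a‖ + d)| + |log ‖a‖| with hC₀
  have hC₀0 : 0 ≤ C₀ := by
    have := log_nonneg (by linarith : (1 : ℝ) ≤ 1 + d)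
    positivity
  refine ⟨C₀ + log 3 + log 3, by positivity, fun u r hr ↦ ?_⟩
  have hr0 : 0 < r := by linarith
  -- The preimage of `u`: the singularity of `log ‖a * z + b - u‖` sits at `v`.
  set v : ℂ := (u - b) / a with hv
  have hav (z : ℂ) : ‖a * z + b - u‖ = ‖a‖ * ‖z - v‖ := by
    rw [← norm_mul, hv]; congr 1; field_simp; ring
  -- Nonnegative with mean at most `log 3`; `φ u` bounds the difference from above and `φ v` bounds
  -- its negative, up to constants.
  set φ : ℂ → ℂ → ℝ := fun u z ↦ log (‖z - u‖ + r) - log ‖z - u‖ with hφ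
  have hφi (u : ℂ) : CircleIntegrable (φ u) 0 r :=
    (circleIntegrable_log_norm_sub_add u hr0).sub (circleIntegrable_log_norm_sub_const r)
  have hi : CircleIntegrable (fun z ↦ C₀ + φ u z) 0 r := (circleIntegrable_const C₀ 0 r).add (hφi u)
  calc _ ≤ circleAverage (fun z ↦ C₀ + φ u z + φ v z) 0 r := by
        refine circleAverage_mono_codiscreteWithin
          ((circleIntegrable_log_norm_affine_sub a b u r).sub
            (circleIntegrable_log_norm_sub_const r)).abs (hi.add (hφi v)) hr0.ne' ?_
        filter_upwards [eventually_ne_codiscreteWithin _ u, eventually_ne_codiscreteWithin _ v,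
          self_mem_codiscreteWithin _] with z hzu hzv hz
        rw [mem_sphere_zero_iff_norm, abs_of_pos hr0] at hz
        have hzu' : 0 < ‖z - u‖ := norm_pos_iff.2 (sub_ne_zero.2 hzu)
        have hzv' : 0 < ‖z - v‖ := norm_pos_iff.2 (sub_ne_zero.2 hzv)
        have hφ0 (w : ℂ) (hw : 0 < ‖z - w‖) : 0 ≤ φ w z :=
          sub_nonneg.2 (log_le_log hw (by linarith))
        have hw : ‖(a - 1) * z + b‖ ≤ d * r := by
          calc _ ≤ ‖a - 1‖ * r + ‖b‖ * 1 := by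
                rw [← hz, mul_one, ← norm_mul]; exact norm_add_le _ _
            _ ≤ ‖a - 1‖ * r + ‖b‖ * r := by gcongr
            _ = d * r := by rw [hd]; ring
        have h₁ : ‖a * z + b - u‖ ≤ (1 + d) * (‖z - u‖ + r) := by
          calc _ = ‖(z - u) + ((a - 1) * z + b)‖ := by congr 1; ring
            _ ≤ ‖z - u‖ + d * r := (norm_add_le _ _).trans (by gcongr)
            _ ≤ _ := by nlinarith
        have h₂ : ‖z - u‖ ≤ (‖a‖ + d) * (‖z - v‖ + r) := by
          calc _ = ‖(a * z + b - u) - ((a - 1) * z + b)‖ := by congr 1; ring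
            _ ≤ ‖a‖ * ‖z - v‖ + d * r := (norm_sub_le _ _).trans (by rw [hav]; gcongr)
            _ ≤ _ := by nlinarith
        have h₁' := log_le_log (by rw [hav]; positivity) h₁
        have h₂' := log_le_log hzu' h₂
        rw [log_mul (by positivity) (by positivity)] at h₁' h₂'
        have h₃ : log ‖a * z + b - u‖ = log ‖a‖ + log ‖z - v‖ := by
          rw [hav, log_mul ha'.ne' hzv'.ne']
        have e₁ := le_abs_self (log (‖a‖ + d))
        have e₂ := neg_abs_le (log ‖a‖)
        have e₃ := log_nonneg (by linarith : (1 : ℝ) ≤ 1 + d)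
        have e₄ := hφ0 u hzu'
        have e₅ := hφ0 v hzv'
        have e₆ := abs_nonneg (log (‖a‖ + d))
        have e₇ := abs_nonneg (log ‖a‖)
        simp only [hφ] at e₄ e₅ ⊢
        rw [abs_le]
        constructor <;> linarith
    _ = C₀ + circleAverage (φ u) 0 r + circleAverage (φ v) 0 r := by
        rw [circleAverage_fun_add hi (hφi v),
          circleAverage_fun_add (circleIntegrable_const C₀ 0 r) (hφi u), circleAverage_const]
    _ ≤ C₀ + log 3 + log 3 := by
        gcongr <;> exact circleAverage_log_norm_sub_add_sub_log_norm_sub_le _ hr0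

/-! ### Harmonic functions and exceptional discrete sets. -/

/-- Difference estimate for harmonic functions well inside a disk, by Poisson's formula. -/
theorem InnerProductSpace.HarmonicOnNhd.abs_sub_le {f : ℂ → ℝ} {R s : ℝ} {z w : ℂ}
    (hf : InnerProductSpace.HarmonicOnNhd f (closedBall 0 R)) (hR : 0 < R) (hs : 2 * s ≤ R)
    (hz : ‖z‖ ≤ s) (hw : ‖w‖ ≤ s) :
    |f w - f z| ≤ 16 * s / R * circleAverage |f| 0 R := by
  have hs0 : 0 ≤ s := (norm_nonneg z).trans hz
  have hzb : z ∈ ball (0 : ℂ) R := by simp; linarith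
  have hwb : w ∈ ball (0 : ℂ) R := by simp; linarith
  have hfc : ContinuousOn f (sphere 0 |R|) := fun x hx ↦
    (hf x (by rw [abs_of_pos hR] at hx; exact sphere_subset_closedBall hx)).1
      |>.continuousAt.continuousWithinAt
  have hi (w : ℂ) (hw : w ∈ ball (0 : ℂ) R) :
      CircleIntegrable ((Complex.re ∘ herglotzRieszKernel 0 w) • f) 0 R :=
    ((Complex.continuous_re.comp_continuousOn
      (continuousOn_herglotzRieszKernel_sphere hw)).smul hfc).circleIntegrable'
  rw [← hf.circleAverage_re_herglotzRieszKernel_smul hzb,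
    ← hf.circleAverage_re_herglotzRieszKernel_smul hwb,
    ← circleAverage_sub (hi w hwb) (hi z hzb), ← smul_eq_mul, ← circleAverage_smul]
  refine abs_circleAverage_le_circleAverage_abs.trans (circleAverage_mono
    ((hi w hwb).sub (hi z hzb)).abs ((hfc.abs.circleIntegrable').const_smul) fun x hx ↦ ?_)
  rw [mem_sphere_zero_iff_norm, abs_of_pos hR] at hx
  -- Both factors in the denominator of the kernel difference are at least `R / 2`, which produces
  -- the constant 16.
  have hk (w : ℂ) (hw : ‖w‖ ≤ s) : R / 2 ≤ ‖x - w‖ := by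
    have := norm_sub_norm_le x w
    linarith
  have hxz := hk z hz
  have hxw := hk w hw
  have hxz0 : x - z ≠ 0 := norm_pos_iff.1 (by linarith)
  have hxw0 : x - w ≠ 0 := norm_pos_iff.1 (by linarith)
  change |(herglotzRieszKernel 0 w x).re * f x - (herglotzRieszKernel 0 z x).re * f x|
    ≤ 16 * s / R * |f x|
  rw [← sub_mul, abs_mul]
  gcongr
  rw [← Complex.sub_re]
  refine (Complex.abs_re_le_norm _).trans ?_
  have e : herglotzRieszKernel 0 w x - herglotzRieszKernel 0 z x
      = 2 * x * (w - z) / ((x - w) * (x - z)) := by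
    simp only [herglotzRieszKernel_def, sub_zero]
    field_simp
    ring
  rw [e, norm_div, norm_mul, norm_mul, norm_mul, hx, Complex.norm_ofNat]
  have hwz : ‖w - z‖ ≤ 2 * s := (norm_sub_le _ _).trans (by linarith)
  calc 2 * R * ‖w - z‖ / (‖x - w‖ * ‖x - z‖) ≤ 2 * R * (2 * s) / ((R / 2) * (R / 2)) := by gcongr
    _ = 16 * s / R := by field_simp; ring

theorem preimage_affine_mem_codiscreteWithin {a : ℂ} (ha : a ≠ 0) (b : ℂ) {U V E : Set ℂ}
    (hE : E ∈ codiscreteWithin U) (hV : MapsTo (fun z ↦ a * z + b) V U) :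
    (fun z ↦ a * z + b) ⁻¹' E ∈ codiscreteWithin V := by
  refine AnalyticOnNhd.preimage_mem_codiscreteWithin (fun z _ ↦ by fun_prop) (fun x _ h ↦ ?_)
    (codiscreteWithin_mono (image_subset_iff.2 hV) hE)
  have hd : HasDerivAt (fun z : ℂ ↦ a * z + b) a x := by
    simpa using ((hasDerivAt_id x).const_mul a).add_const b
  obtain ⟨y, hy⟩ := eventuallyConst_iff_exists_eventuallyEq.1 h
  exact ha (hd.unique ((hasDerivAt_const x y).congr_of_eventuallyEq hy))

/-! ### Counting zeros and poles; means of `|log ‖g‖|`. -/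

/-- The number of zeros and poles of `g` in the closed disk of radius `R`, with multiplicity. -/
noncomputable def zeroPoleCount (g : ℂ → ℂ) (R : ℝ) : ℝ :=
  ∑ᶠ u, |(divisor g (closedBall 0 |R|) u : ℝ)|

theorem zeroPoleCount_eq_sum (g : ℂ → ℂ) (R : ℝ) :
    zeroPoleCount g R = ∑ u ∈ ((divisor g (closedBall 0 |R|)).finiteSupport
      (isCompact_closedBall 0 |R|)).toFinset, |(divisor g (closedBall 0 |R|) u : ℝ)| := by
  refine finsum_eq_sum_of_support_subset _ fun u hu ↦ ?_
  simpa using hu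

theorem zeroPoleCount_nonneg (g : ℂ → ℂ) (R : ℝ) : 0 ≤ zeroPoleCount g R :=
  finsum_nonneg fun _ ↦ abs_nonneg _

/-- A zero or pole with `‖u‖ ≤ R` contributes at least `log (R ^ 2 / R) = log R` to the counting
functions at radius `R ^ 2`. -/
theorem zeroPoleCount_mul_log_le {g : ℂ → ℂ} (hg : Meromorphic g) {R : ℝ} (hR : 1 ≤ R) :
    zeroPoleCount g R * log R ≤ ValueDistribution.logCounting g 0 (R ^ 2)
      + ValueDistribution.logCounting g ⊤ (R ^ 2) := by
  have hR0 : 0 < R := by linarith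
  have hRR : R ≤ R ^ 2 := by nlinarith
  set D := divisor g univ with hD
  set P := (D⁺ + D⁻).toClosedBall (R ^ 2) with hP
  have hPu (u : ℂ) (hu : ‖u‖ ≤ R ^ 2) : (P u : ℝ) = |(D u : ℝ)| := by
    rw [hP, Function.locallyFinsuppWithin.toClosedBall_eval_within _
      (by simpa [abs_of_pos hR0] using hu)]
    rw [← Int.cast_abs, ← posPart_add_negPart (D u)]
    rfl
  rw [ValueDistribution.logCounting_zero, ValueDistribution.logCounting_top, ← Pi.add_apply,
    ← map_add]
  have hPf := P.finiteSupport (isCompact_closedBall 0 |R ^ 2|)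
  have h0 : ((D⁺ + D⁻) 0 : ℝ) = P 0 := by
    rw [hP, Function.locallyFinsuppWithin.toClosedBall_eval_within _ (by simp; positivity)]
  have h₁ : (D⁺ + D⁻).logCounting (R ^ 2)
      = ∑ u ∈ hPf.toFinset, (P u : ℝ) * (log (R ^ 2) - log ‖u‖) := by
    change ∑ᶠ z, (P z : ℝ) * log (R ^ 2 * ‖z‖⁻¹) + ((D⁺ + D⁻) 0 : ℝ) * log (R ^ 2) = _
    -- Since `log 0 = 0`, the separate term at the origin is absorbed into a single sum of `log (R ^
    -- 2) - log ‖u‖`.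
    have := countingFunction_finsum_eq_finsum_add (c := 0) (R := R ^ 2) (by positivity) hPf
    simp only [zero_sub, norm_neg] at this
    rw [h0, ← this]
    refine finsum_eq_sum_of_support_subset _ fun u hu ↦ ?_
    simp only [Function.mem_support, ne_eq, mul_eq_zero, not_or, Int.cast_eq_zero] at hu
    simpa using hu.1
  rw [h₁, zeroPoleCount_eq_sum, Finset.sum_mul]
  have hmem (u : ℂ) (hu : divisor g (closedBall 0 |R|) u ≠ 0) : ‖u‖ ≤ R := by
    by_contra hc
    exact hu ((divisor g (closedBall 0 |R|)).apply_eq_zero_of_notMem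
      (by simpa [abs_of_pos hR0] using hc))
  have hDu (u : ℂ) (hu : ‖u‖ ≤ R) : divisor g (closedBall 0 |R|) u = D u := by
    rw [Function.locallyFinsuppWithin.toClosedBall_divisor hg,
      Function.locallyFinsuppWithin.toClosedBall_eval_within _
      (by simpa [abs_of_pos hR0] using hu)]
  have hlogR : 0 ≤ log R := log_nonneg hR
  have hlog2 : log (R ^ 2) = 2 * log R := by simp
  calc _ ≤ ∑ u ∈ ((divisor g (closedBall 0 |R|)).finiteSupport
        (isCompact_closedBall 0 |R|)).toFinset, (P u : ℝ) * (log (R ^ 2) - log ‖u‖) := by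
        refine Finset.sum_le_sum fun u hu ↦ ?_
        have hu' := hmem u (by simpa using hu)
        rw [hPu u (hu'.trans hRR), hDu u hu']
        gcongr
        rcases eq_or_ne u 0 with rfl | h
        · simp; linarith
        · have := log_le_log (norm_pos_iff.2 h) hu'
          linarith
    _ ≤ _ := by
        refine Finset.sum_le_sum_of_subset_of_nonneg (fun u hu ↦ ?_) fun u hu _ ↦ ?_
        · have hu0 : divisor g (closedBall 0 |R|) u ≠ 0 := by simpa using hu
          have hu' := hmem u hu0
          have : (P u : ℝ) ≠ 0 := by
            rw [hPu u (hu'.trans hRR), abs_ne_zero, Int.cast_ne_zero, ← hDu u hu']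
            exact hu0
          simpa using this
        · have hu0 : P u ≠ 0 := by simpa using hu
          have hu' : ‖u‖ ≤ R ^ 2 := by
            by_contra hc
            exact hu0 (P.apply_eq_zero_of_notMem (by simpa [abs_of_pos hR0] using hc))
          rw [hPu u hu']
          refine mul_nonneg (abs_nonneg _) ?_
          rcases eq_or_ne u 0 with rfl | h
          · simp; linarith
          · exact sub_nonneg.2 (log_le_log (norm_pos_iff.2 h) hu')

/-- Use `|log x| = 2 * log⁺ x - log x`; the mean of the last logarithm is `log R ≥ 0` and can be
dropped. -/
theorem circleAverage_abs_log_norm_sub_le {R : ℝ} (hR : 1 ≤ R) {u : ℂ} (hu : ‖u‖ ≤ R) :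
    circleAverage (fun z ↦ |log ‖z - u‖|) 0 R ≤ 2 * log (2 * R) := by
  have hR0 : 0 < R := by linarith
  have hm : MeromorphicOn (fun z ↦ z - u) (sphere 0 |R|) := fun _ _ ↦ by fun_prop
  have hi := hm.circleIntegrable_posLog_norm
  have hi' : CircleIntegrable (fun z ↦ 2 * log⁺ ‖z - u‖) 0 R := hi.const_smul (a := (2 : ℝ))
  have e : (fun z ↦ |log ‖z - u‖|) = fun z ↦ 2 * log⁺ ‖z - u‖ - log ‖z - u‖ := by
    ext z
    rw [posLog_apply]
    rcases le_total 0 (log ‖z - u‖) with h | h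
    · rw [abs_of_nonneg h, max_eq_right h]; ring
    · rw [abs_of_nonpos h, max_eq_left h]; ring
  rw [e, circleAverage_fun_sub hi' (circleIntegrable_log_norm_sub_const R),
    circleAverage_log_norm_sub_const_of_mem_closedBall (by simpa [abs_of_pos hR0] using hu)]
  have : circleAverage (fun z ↦ 2 * log⁺ ‖z - u‖) 0 R ≤ 2 * log (2 * R) := by
    refine circleAverage_mono_on_of_le_circle hi' fun z hz ↦ ?_
    rw [mem_sphere_zero_iff_norm, abs_of_pos hR0] at hz
    gcongr
    rw [posLog_eq_log_max_one (norm_nonneg _)]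
    refine log_le_log (by positivity) (max_le (by linarith) ?_)
    exact (norm_sub_le _ _).trans (by linarith)
  have := log_nonneg hR
  linarith

theorem circleAverage_abs_log_norm_eq {g : ℂ → ℂ} (hg : Meromorphic g) (R : ℝ) :
    circleAverage (fun z ↦ |log ‖g z‖|) 0 R
      = ValueDistribution.proximity g ⊤ R + ValueDistribution.proximity g 0 R := by
  rw [ValueDistribution.proximity_top, ValueDistribution.proximity_zero_of_complexValued,
    ← circleAverage_add hg.meromorphicOn.circleIntegrable_posLog_norm
      hg.inv.meromorphicOn.circleIntegrable_posLog_norm]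
  congr 1
  ext z
  simp only [Pi.add_apply, Pi.inv_apply, norm_inv, posLog_apply, log_inv]
  rcases le_total 0 (log ‖g z‖) with h | h
  · rw [abs_of_nonneg h, max_eq_right h, max_eq_left (by linarith)]; ring
  · rw [abs_of_nonpos h, max_eq_left h, max_eq_right (by linarith)]; ring

theorem posLog_norm_div_le_abs (x y : ℂ) : log⁺ ‖x / y‖ ≤ |log ‖x‖ - log ‖y‖| := by
  rcases eq_or_ne x 0 with rfl | hx
  · simp
  rcases eq_or_ne y 0 with rfl | hy
  · simp
  rw [norm_div, posLog_apply, log_div (norm_ne_zero_iff.2 hx) (norm_ne_zero_iff.2 hy)]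
  exact max_le (abs_nonneg _) (le_abs_self _)

/-! ### Proximity of an affine quotient at a fixed radius. -/

theorem Meromorphic.comp_affine {g : ℂ → ℂ} (hg : Meromorphic g) (a b : ℂ) :
    Meromorphic (fun z ↦ g (a * z + b)) := fun z ↦
  (hg (a * z + b)).comp_analyticAt (g := fun z ↦ a * z + b) (by fun_prop)

/-- Estimate for the proximity function of the quotient `g (a z + b) / g z` at radius `r` in terms of
the zeros, the poles and the proximity functions of `g` on a larger disk. -/
theorem exists_proximity_comp_affine_div_le {a : ℂ} (ha : a ≠ 0) (b : ℂ) :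
    ∃ C : ℝ, 0 ≤ C ∧ ∀ g : ℂ → ℂ, Meromorphic g → (∀ z, meromorphicOrderAt g z ≠ ⊤) →
      ∀ r s R : ℝ, 1 ≤ r → r ≤ s → ‖a‖ * r + ‖b‖ ≤ s → 2 * s ≤ R →
      ValueDistribution.proximity (fun z ↦ g (a * z + b) / g z) ⊤ r ≤
        C * zeroPoleCount g R + 16 * s / R * (ValueDistribution.proximity g ⊤ R
          + ValueDistribution.proximity g 0 R + 2 * log (2 * R) * zeroPoleCount g R) := by
  obtain ⟨C, hC0, hC⟩ := exists_circleAverage_abs_log_norm_affine_sub_le ha b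
  refine ⟨C, hC0, fun g hg ho r s R hr hrs has hsR ↦ ?_⟩
  have hr0 : 0 < r := by linarith
  have hR0 : 0 < R := by linarith
  set U : Set ℂ := closedBall 0 |R| with hU
  set D := divisor g U with hD
  have hDf := D.finiteSupport (isCompact_closedBall 0 |R|)
  set S := hDf.toFinset with hS
  obtain ⟨h, hh, hh0, hgh⟩ := (hg.meromorphicOn (s := U)).extract_zeros_poles
    (fun u ↦ ho u) hDf
  have hlog : (fun z ↦ log ‖g z‖) =ᶠ[codiscreteWithin U]
      (∑ᶠ u, fun z ↦ (D u : ℝ) * log ‖z - u‖) + (fun z ↦ log ‖h z‖) := extract_zeros_poles_log hh0 hgh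
  -- The points where the factorization holds exactly; below it is needed at both `z` and `a * z +
  -- b`.
  set E : Set ℂ := {z | log ‖g z‖ = ∑ u ∈ S, (D u : ℝ) * log ‖z - u‖ + log ‖h z‖} with hE
  have hEU : E ∈ codiscreteWithin U := by
    filter_upwards [hlog] with z hz
    rw [hE, mem_ofPred_eq, hz, Pi.add_apply, finsum_eq_sum_of_support_subset (s := S)]
    · simp
    · intro u hu
      contrapose! hu
      have : D u = 0 := by simpa [hS] using hu
      simp only [Function.mem_support, ne_eq, not_not]
      ext z
      simp [this]
  have hcount : zeroPoleCount g R = ∑ u ∈ S, |(D u : ℝ)| := zeroPoleCount_eq_sum g R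
  have hharm : InnerProductSpace.HarmonicOnNhd (fun z ↦ log ‖h z‖) (closedBall 0 R) := fun x hx ↦
    (hh x (by rwa [hU, abs_of_pos hR0])).harmonicAt_log_norm
      (hh0 ⟨x, by rwa [hU, abs_of_pos hR0]⟩)
  set B : ℝ := 16 * s / R * circleAverage |fun z ↦ log ‖h z‖| 0 R with hB
  have hSR : sphere (0 : ℂ) |R| ⊆ U := sphere_subset_closedBall
  have hrU : sphere (0 : ℂ) |r| ⊆ U :=
    sphere_subset_closedBall.trans (closedBall_subset_closedBall (by
      rw [abs_of_pos hr0, abs_of_pos hR0]; linarith))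
  have hnorm (z : ℂ) (hz : z ∈ sphere (0 : ℂ) |r|) : ‖z‖ = r := by
    rwa [mem_sphere_zero_iff_norm, abs_of_pos hr0] at hz
  have hws (z : ℂ) (hz : z ∈ sphere (0 : ℂ) |r|) : ‖a * z + b‖ ≤ s := by
    refine (norm_add_le _ _).trans ?_
    rwa [norm_mul, hnorm z hz]
  have hmaps : MapsTo (fun z ↦ a * z + b) (sphere (0 : ℂ) |r|) U := fun z hz ↦ by
    have := hws z hz
    rw [hU, mem_closedBall_zero_iff, abs_of_pos hR0]
    linarith
  have hmain : ValueDistribution.proximity (fun z ↦ g (a * z + b) / g z) ⊤ r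
      ≤ C * zeroPoleCount g R + B := by
    have hi (u : ℂ) : CircleIntegrable
        (fun z ↦ |(D u : ℝ)| * |log ‖a * z + b - u‖ - log ‖z - u‖|) 0 r :=
      ((circleIntegrable_log_norm_affine_sub a b u r).sub
        (circleIntegrable_log_norm_sub_const r)).abs.const_smul (a := |(D u : ℝ)|)
    have hisum : CircleIntegrable
        (fun z ↦ ∑ u ∈ S, |(D u : ℝ)| * |log ‖a * z + b - u‖ - log ‖z - u‖|) 0 r :=
      CircleIntegrable.fun_sum S fun u _ ↦ hi u
    rw [ValueDistribution.proximity_top]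
    calc _ ≤ circleAverage (fun z ↦
          ∑ u ∈ S, |(D u : ℝ)| * |log ‖a * z + b - u‖ - log ‖z - u‖| + B) 0 r := by
          refine circleAverage_mono_codiscreteWithin
            ((hg.comp_affine a b).div hg).meromorphicOn.circleIntegrable_posLog_norm
            (hisum.add (circleIntegrable_const B 0 r)) hr0.ne' ?_
          filter_upwards [self_mem_codiscreteWithin _, codiscreteWithin_mono hrU hEU,
            preimage_affine_mem_codiscreteWithin ha b hEU hmaps] with z hz hz₁ hz₂
          rw [mem_preimage] at hz₂
          simp only [hE, mem_ofPred_eq] at hz₁ hz₂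
          refine (posLog_norm_div_le_abs _ _).trans ?_
          rw [hz₁, hz₂, add_sub_add_comm, ← Finset.sum_sub_distrib]
          refine (abs_add_le _ _).trans (add_le_add ?_ ?_)
          · refine (Finset.abs_sum_le_sum_abs _ _).trans (Finset.sum_le_sum fun u _ ↦ ?_)
            rw [← mul_sub, abs_mul]
          · exact hharm.abs_sub_le hR0 hsR ((hnorm z hz).le.trans hrs) (hws z hz)
      _ = ∑ u ∈ S, |(D u : ℝ)| *
            circleAverage (fun z ↦ |log ‖a * z + b - u‖ - log ‖z - u‖|) 0 r + B := by
          rw [circleAverage_fun_add hisum (circleIntegrable_const B 0 r), circleAverage_const,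
            circleAverage_fun_sum fun u _ ↦ hi u]
          simp only [← smul_eq_mul, circleAverage_fun_smul]
      _ ≤ ∑ u ∈ S, |(D u : ℝ)| * C + B := by
          gcongr with u
          exact hC u r hr
      _ = C * zeroPoleCount g R + B := by rw [hcount, ← Finset.sum_mul, mul_comm]
  refine hmain.trans ?_
  rw [hB]
  have hs0 : 0 ≤ s := by linarith
  gcongr
  have hi (u : ℂ) : CircleIntegrable (fun z ↦ |(D u : ℝ)| * |log ‖z - u‖|) 0 R :=
    (circleIntegrable_log_norm_sub_const R).abs.const_smul (a := |(D u : ℝ)|)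
  have hisum : CircleIntegrable (fun z ↦ ∑ u ∈ S, |(D u : ℝ)| * |log ‖z - u‖|) 0 R :=
    CircleIntegrable.fun_sum S fun u _ ↦ hi u
  have hig : CircleIntegrable (fun z ↦ |log ‖g z‖|) 0 R :=
    hg.meromorphicOn.circleIntegrable_log_norm.abs
  -- On the circle of radius `R`, solve the factorization for `log ‖h‖`.
  calc _ ≤ circleAverage (fun z ↦ |log ‖g z‖| + ∑ u ∈ S, |(D u : ℝ)| * |log ‖z - u‖|) 0 R := by
        refine circleAverage_mono_codiscreteWithin
          ((hh.mono hSR).meromorphicOn.circleIntegrable_log_norm.abs) (hig.add hisum) hR0.ne' ?_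
        filter_upwards [codiscreteWithin_mono hSR hEU] with z hz
        simp only [hE, mem_ofPred_eq] at hz
        have e : log ‖h z‖ = log ‖g z‖ - ∑ u ∈ S, (D u : ℝ) * log ‖z - u‖ := by linarith
        rw [Pi.abs_apply, e]
        refine (abs_sub _ _).trans (add_le_add le_rfl ?_)
        refine (Finset.abs_sum_le_sum_abs _ _).trans (Finset.sum_le_sum fun u _ ↦ ?_)
        rw [abs_mul]
    _ = circleAverage (fun z ↦ |log ‖g z‖|) 0 R
          + ∑ u ∈ S, |(D u : ℝ)| * circleAverage (fun z ↦ |log ‖z - u‖|) 0 R := by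
        rw [circleAverage_fun_add hig hisum, circleAverage_fun_sum fun u _ ↦ hi u]
        simp only [← smul_eq_mul, circleAverage_fun_smul]
    _ ≤ _ := by
        rw [circleAverage_abs_log_norm_eq hg, hcount, Finset.mul_sum]
        refine add_le_add le_rfl (Finset.sum_le_sum fun u hu ↦ ?_)
        rw [mul_comm]
        refine mul_le_mul_of_nonneg_right ?_ (abs_nonneg _)
        refine circleAverage_abs_log_norm_sub_le (by linarith) ?_
        by_contra hc
        exact (by simpa [hS] using hu : D u ≠ 0) (D.apply_eq_zero_of_notMem
          (by simpa [hU, abs_of_pos hR0] using hc))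

/-! ### Growth of the characteristic. -/

theorem meromorphicOrderAt_ne_top_of_not_isConstantMeromorphic {g : ℂ → ℂ} (hg : Meromorphic g)
    (hnc : ¬ IsConstantMeromorphic g) (z : ℂ) : meromorphicOrderAt g z ≠ ⊤ := by
  revert z
  rw [← hg.exists_meromorphicOrderAt_ne_top_iff_forall]
  by_contra! h
  refine hnc ⟨0, ?_⟩
  change {z | g z = 0} ∈ codiscrete ℂ
  rw [mem_codiscrete]
  intro x
  rw [disjoint_principal_right, compl_compl]
  exact meromorphicOrderAt_eq_top_iff.1 (h x)

theorem IsConstantMeromorphic.of_sub_const {g : ℂ → ℂ} {a : ℂ}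
    (h : IsConstantMeromorphic (fun z ↦ g z - a)) : IsConstantMeromorphic g := by
  obtain ⟨b, hb⟩ := h
  refine ⟨b + a, ?_⟩
  filter_upwards [hb] with z hz
  rw [← hz, sub_add_cancel]

theorem exists_characteristic_inv_le {g : ℂ → ℂ} (hg : Meromorphic g) :
    ∃ C : ℝ, 0 ≤ C ∧ ∀ r, characteristic g⁻¹ ⊤ r ≤ characteristic g ⊤ r + C :=
  ⟨max |log ‖g 0‖| |log ‖meromorphicTrailingCoeffAt g 0‖|, by positivity, fun r ↦ by
    have := (abs_le.1 (characteristic_sub_characteristic_inv_le hg (R := r))).1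
    linarith⟩

/-- The characteristic of a non-constant meromorphic function grows at least like `log r`. -/
theorem exists_log_le_characteristic_add {g : ℂ → ℂ} (hg : Meromorphic g)
    (hnc : ¬ IsConstantMeromorphic g) :
    ∃ C : ℝ, ∀ᶠ r in atTop, log r ≤ characteristic g ⊤ r + C := by
  classical
  obtain ⟨z₀, hz₀⟩ := (hg 0).eventually_analyticAt.exists
  -- Analyticity at `z₀` makes `z₀` a genuine zero of `f`, so `N(r, 1/f) ≥ log r - log ‖z₀‖`; the
  -- first main theorem transfers this to `g`.
  set f : ℂ → ℂ := fun z ↦ g z - g z₀ with hf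
  have hfm : Meromorphic f := fun z ↦ (hg z).sub (MeromorphicAt.const _ _)
  have hfa : AnalyticAt ℂ f z₀ := hz₀.sub analyticAt_const
  have hfo := meromorphicOrderAt_ne_top_of_not_isConstantMeromorphic hfm
    (fun h ↦ hnc h.of_sub_const) z₀
  obtain ⟨C, -, hC⟩ := exists_characteristic_inv_le hfm
  refine ⟨log ‖z₀‖ + C + (log⁺ ‖g z₀‖ + log 2), ?_⟩
  filter_upwards [eventually_ge_atTop 1, eventually_ge_atTop ‖z₀‖] with r hr hrz
  have hdiv : 1 ≤ divisor f univ z₀ := by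
    rw [divisor_apply hfm.meromorphicOn (mem_univ _)]
    have hpos : 0 < meromorphicOrderAt f z₀ := by
      refine lt_of_le_of_ne hfa.meromorphicOrderAt_nonneg fun h ↦ ?_
      exact (hfa.meromorphicNFAt.meromorphicOrderAt_eq_zero_iff.1 h.symm) (by simp [hf])
    lift meromorphicOrderAt f z₀ to ℤ using hfo with n
    rw [WithTop.untop₀_coe]
    exact Int.add_one_le_iff.2 (by exact_mod_cast hpos)
  have hle : Function.locallyFinsuppWithin.single z₀ 1 ≤ (divisor f univ)⁺ := by
    intro z
    by_cases hz : z = z₀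
    · subst hz
      simpa using hdiv.trans (le_posPart _)
    · simp [Function.locallyFinsuppWithin.single_apply, hz, posPart_nonneg]
  have h₁ : log r - log ‖z₀‖ ≤ logCounting f 0 r := by
    rw [logCounting_zero]
    have := Function.locallyFinsuppWithin.logCounting_le hle hr
    rwa [Function.locallyFinsuppWithin.logCounting_single_eq_log_sub_const hrz, Int.cast_one,
      one_mul] at this
  have h₂ : logCounting f 0 r ≤ characteristic f⁻¹ ⊤ r := by
    rw [characteristic, Pi.add_apply, logCounting_inv]
    exact le_add_of_nonneg_left (proximity_nonneg r)
  have h₃ := hC r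
  have h₄ := (abs_le.1 (abs_characteristic_sub_characteristic_shift_le hg (a₀ := g z₀)
    (r := r))).1
  linarith

theorem eventually_characteristic_le_log_rpow {g : ℂ → ℂ} (hfin : logarithmicOrder g < ⊤)
    {ε : ℝ} (hε : 0 < ε) :
    ∀ᶠ r in atTop, characteristic g ⊤ r ≤ log r ^ ((logarithmicOrder g).toReal + ε) := by
  have hloglog : ∀ᶠ r : ℝ in atTop, 1 < log r := tendsto_log_atTop.eventually_gt_atTop 1
  -- Excludes `⊥`, so that `toReal` carries no default value.
  have h0 : 0 ≤ logarithmicOrder g := by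
    refine le_limsup_of_frequently_le (Eventually.frequently ?_)
    filter_upwards [hloglog] with r hr
    exact EReal.coe_nonneg.2 (div_nonneg posLog_nonneg (log_nonneg hr.le))
  have hcoe : ((logarithmicOrder g).toReal : EReal) = logarithmicOrder g :=
    EReal.coe_toReal hfin.ne (ne_bot_of_le_ne_bot (by simp) h0)
  have hlt : logarithmicOrder g < ((logarithmicOrder g).toReal + ε : ℝ) := by
    rw [← hcoe, EReal.toReal_coe]
    exact EReal.coe_lt_coe_iff.2 (by linarith)
  filter_upwards [hloglog, eventually_lt_of_limsup_lt hlt] with r hr hT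
  have hL : 0 < log (log r) := log_pos hr
  rw [EReal.coe_lt_coe_iff, div_lt_iff₀ hL] at hT
  rw [rpow_def_of_pos (by linarith)]
  calc characteristic g ⊤ r ≤ exp (log⁺ (characteristic g ⊤ r)) := by
        rcases le_or_gt (characteristic g ⊤ r) 0 with h | h
        · exact h.trans (exp_pos _).le
        · conv_lhs => rw [← exp_log h]
          exact exp_le_exp.2 (le_max_right _ _)
    _ ≤ _ := exp_le_exp.2 (by rw [mul_comm]; exact hT.le)

/-- Allows bounded terms to be absorbed into `log r ^ (τ - 1)`: growth at least like `log r` keeps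
this power away from 0. -/
theorem eventually_one_le_two_mul_log_rpow {g : ℂ → ℂ} (hg : Meromorphic g)
    (hnc : ¬ IsConstantMeromorphic g) {τ : ℝ}
    (hT : ∀ᶠ r in atTop, ValueDistribution.characteristic g ⊤ r ≤ log r ^ τ) :
    ∀ᶠ r : ℝ in atTop, 1 ≤ 2 * log r ^ (τ - 1) := by
  obtain ⟨C, hC⟩ := exists_log_le_characteristic_add hg hnc
  filter_upwards [hC, hT, tendsto_log_atTop.eventually_ge_atTop (2 * C),
    tendsto_log_atTop.eventually_ge_atTop 1] with r h₁ h₂ h₃ h₄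
  have hL : 0 < log r := by linarith
  rw [rpow_sub_one hL.ne', mul_div_assoc', le_div_iff₀ hL]
  linarith

/-! ### Affine quotients for finite logarithmic order. -/

theorem isBigO_proximity_comp_affine_div {g : ℂ → ℂ} (hg : Meromorphic g)
    (hnc : ¬ IsConstantMeromorphic g) {τ : ℝ}
    (hT : ∀ᶠ r in atTop, characteristic g ⊤ r ≤ log r ^ τ) {a : ℂ} (ha : a ≠ 0) (b : ℂ) :
    (fun r ↦ proximity (fun z ↦ g (a * z + b) / g z) ⊤ r) =O[atTop]
      fun r ↦ log r ^ (τ - 1) := by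
  obtain ⟨C, hC0, hC⟩ := exists_proximity_comp_affine_div_le ha b
  obtain ⟨C', hC'0, hC'⟩ := exists_characteristic_inv_le hg
  set A : ℝ := 1 + ‖a‖ + ‖b‖ with hA
  have hA1 : 1 ≤ A := by rw [hA]; linarith [norm_nonneg a, norm_nonneg b]
  set K : ℝ := 4 ^ τ + C' with hK
  have hK0 : 0 ≤ K := by positivity
  have hpow (n : ℕ) (hn : n ≠ 0) : Tendsto (fun r : ℝ ↦ r ^ n) atTop atTop := tendsto_pow_atTop hn
  refine IsBigO.of_bound (C * K + 16 * A * (2 * 2 ^ τ + 2 * C' + 6 * K)) ?_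
  filter_upwards [eventually_ge_atTop (2 * A), tendsto_log_atTop.eventually_ge_atTop 1,
    eventually_one_le_two_mul_log_rpow hg hnc hT, (hpow 2 two_ne_zero).eventually hT,
    (hpow 4 four_ne_zero).eventually hT] with r hrA hL h1 hT2 hT4
  have hr1 : 1 ≤ r := by linarith
  have hr0 : 0 < r := by linarith
  have hL0 : 0 < log r := by linarith
  set L := log r with hLdef
  set X := L ^ (τ - 1) with hX
  have hX0 : 0 ≤ X := by positivity
  have hLX : L ^ τ = L * X := by rw [hX, rpow_sub_one hL0.ne']; field_simp
  have hR1 : 1 ≤ r ^ 2 := one_le_pow₀ hr1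
  rw [log_pow, Nat.cast_ofNat, ← hLdef, mul_rpow (by norm_num) hL0.le, hLX] at hT2 hT4
  have hprox : proximity g ⊤ (r ^ 2) ≤ characteristic g ⊤ (r ^ 2) :=
    le_add_of_nonneg_right (logCounting_nonneg hR1)
  have hprox' : proximity g 0 (r ^ 2) ≤ characteristic g ⊤ (r ^ 2) + C' := by
    refine le_trans ?_ (hC' (r ^ 2))
    rw [← proximity_inv]
    exact le_add_of_nonneg_right (logCounting_nonneg hR1)
  have hcount : zeroPoleCount g (r ^ 2) ≤ K * X := by
    have h₁ := zeroPoleCount_mul_log_le hg hR1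
    have e : (r ^ 2) ^ 2 = r ^ 4 := by ring
    have hR4 : 1 ≤ r ^ 4 := one_le_pow₀ hr1
    rw [e, log_pow, Nat.cast_ofNat, ← hLdef] at h₁
    have h₂ : logCounting g 0 (r ^ 4) ≤ characteristic g ⊤ (r ^ 4) + C' := by
      refine le_trans ?_ (hC' (r ^ 4))
      rw [← logCounting_inv]
      exact le_add_of_nonneg_left (proximity_nonneg _)
    have h₃ : logCounting g ⊤ (r ^ 4) ≤ characteristic g ⊤ (r ^ 4) :=
      le_add_of_nonneg_left (proximity_nonneg _)
    have h₄ : C' ≤ 2 * L * (C' * X) := by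
      calc C' ≤ C' * (2 * X) * L := by nlinarith [mul_nonneg hC'0 hX0]
        _ = _ := by ring
    refine le_of_mul_le_mul_right ?_ (by positivity : 0 < 2 * L)
    calc _ ≤ 2 * (4 ^ τ * (L * X)) + C' := by linarith
      _ ≤ 2 * (4 ^ τ * (L * X)) + 2 * L * (C' * X) := by linarith
      _ = _ := by rw [hK]; ring
  have hn0 := zeroPoleCount_nonneg g (r ^ 2)
  -- Here `s = A * r` and `R = r ^ 2`; `2 * s ≤ R` is the condition `2 * A ≤ r`.
  have hbound := hC g hg (meromorphicOrderAt_ne_top_of_not_isConstantMeromorphic hg hnc)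
    r (A * r) (r ^ 2) hr1 (by nlinarith) (by rw [hA]; nlinarith [norm_nonneg a, norm_nonneg b])
    (by nlinarith)
  have hlog2 : log (2 * r ^ 2) ≤ 3 * L := by
    rw [log_mul (by norm_num) (by positivity), log_pow, Nat.cast_ofNat, ← hLdef]
    linarith [log_two_lt_d9]
  have hlog2' : 0 ≤ log (2 * r ^ 2) := log_nonneg (by linarith)
  have hsum : proximity g ⊤ (r ^ 2) + proximity g 0 (r ^ 2)
      + 2 * log (2 * r ^ 2) * zeroPoleCount g (r ^ 2)
      ≤ (2 * 2 ^ τ + 2 * C' + 6 * K) * (L * X) := by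
    have h₁ : 2 * log (2 * r ^ 2) * zeroPoleCount g (r ^ 2) ≤ 2 * (3 * L) * (K * X) := by gcongr
    have h₂ : C' ≤ 2 * C' * (L * X) := by
      calc C' ≤ C' * (2 * X) * L := by nlinarith [mul_nonneg hC'0 hX0]
        _ = _ := by ring
    calc _ ≤ 2 * (2 ^ τ * (L * X)) + 2 * C' * (L * X) + 2 * (3 * L) * (K * X) := by linarith
      _ = _ := by ring
  rw [norm_of_nonneg (proximity_nonneg r), norm_of_nonneg hX0]
  -- The Poisson term has the extra factor `L`, but `s / R = A / r` more than compensates.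
  have hLr : L / r ≤ 1 := (div_le_one hr0).2 (by linarith [log_le_sub_one_of_pos hr0])
  have h2τ : (0 : ℝ) ≤ 2 ^ τ := by positivity
  calc _ ≤ C * (K * X) + 16 * (A * r) / r ^ 2 * ((2 * 2 ^ τ + 2 * C' + 6 * K) * (L * X)) := by
        refine hbound.trans ?_
        gcongr
    _ = C * (K * X) + 16 * A * (2 * 2 ^ τ + 2 * C' + 6 * K) * X * (L / r) := by
        field_simp
    _ ≤ C * (K * X) + 16 * A * (2 * 2 ^ τ + 2 * C' + 6 * K) * X * 1 := by gcongr
    _ = _ := by ring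

/-! ### From Hahn differences to affine quotients. -/

theorem exists_iterate_affine_eq {q : ℂ} (hq : q ≠ 0) (c : ℂ) (j : ℕ) :
    ∃ a b : ℂ, a ≠ 0 ∧ ∀ z, (fun z ↦ q * z + c)^[j] z = a * z + b := by
  induction j with
  | zero => exact ⟨1, 0, one_ne_zero, fun z ↦ by simp⟩
  | succ j ih =>
    obtain ⟨a, b, ha, h⟩ := ih
    refine ⟨q * a, q * b + c, mul_ne_zero hq ha, fun z ↦ ?_⟩
    rw [Function.iterate_succ_apply', h]
    ring

theorem Meromorphic.hahnDifference {g : ℂ → ℂ} (hg : Meromorphic g) (q c : ℂ) :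
    Meromorphic (hahnDifference q c g) := fun z ↦
  ((hg.comp_affine q c z).sub (hg z)).div (by fun_prop)

theorem Meromorphic.iterate_hahnDifference {g : ℂ → ℂ} (hg : Meromorphic g) (q c : ℂ) (k : ℕ) :
    Meromorphic ((_root_.hahnDifference q c)^[k] g) := by
  induction k with
  | zero => exact hg
  | succ k ih =>
    rw [Function.iterate_succ_apply']
    exact ih.hahnDifference q c

theorem tendsto_affine_cobounded {a : ℂ} (ha : a ≠ 0) (b : ℂ) :
    Tendsto (fun z ↦ a * z + b) (Bornology.cobounded ℂ) (Bornology.cobounded ℂ) := by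
  rw [← tendsto_norm_atTop_iff_cobounded]
  refine tendsto_atTop_mono (fun z ↦ norm_sub_le_norm_add (a * z) b) ?_
  simp only [norm_mul]
  exact tendsto_atTop_add_const_right _ _
    (tendsto_norm_cobounded_atTop.const_mul_atTop (norm_pos_iff.2 ha))

theorem exists_eventually_le_norm_affine {q c : ℂ} (hqc : q ≠ 1 ∨ c ≠ 0) :
    ∃ δ : ℝ, 0 < δ ∧ ∀ᶠ z in Bornology.cobounded ℂ, δ ≤ ‖(q - 1) * z + c‖ := by
  by_cases h : q = 1
  · refine ⟨‖c‖, norm_pos_iff.2 (hqc.resolve_left (not_not.2 h)), ?_⟩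
    simp [h]
  · exact ⟨1, one_pos, (tendsto_norm_atTop_iff_cobounded.2
      (tendsto_affine_cobounded (sub_ne_zero.2 h) c)).eventually_ge_atTop 1⟩

/-- Far away from the origin, iterated Hahn differences are dominated by shifts. -/
theorem exists_norm_iterate_hahnDifference_le (g : ℂ → ℂ) {q c : ℂ} (hq : q ≠ 0)
    (hqc : q ≠ 1 ∨ c ≠ 0) (k : ℕ) :
    ∃ C : ℝ, 0 ≤ C ∧ ∀ᶠ z in Bornology.cobounded ℂ, ‖(hahnDifference q c)^[k] g z‖
      ≤ C * ∑ j ∈ Finset.range (k + 1), ‖g ((fun z ↦ q * z + c)^[j] z)‖ := by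
  obtain ⟨δ, hδ, hδz⟩ := exists_eventually_le_norm_affine hqc
  induction k with
  | zero => exact ⟨1, one_pos.le, by simp⟩
  | succ k ih =>
    obtain ⟨C, hC, h⟩ := ih
    refine ⟨(C + C) / δ, by positivity, ?_⟩
    filter_upwards [hδz, h, (tendsto_affine_cobounded hq c).eventually h] with z h₁ h₂ h₃
    simp only [← Function.iterate_succ_apply] at h₃
    have h₂' : ∑ j ∈ Finset.range (k + 1), ‖g ((fun z ↦ q * z + c)^[j] z)‖
        ≤ ∑ j ∈ Finset.range (k + 1 + 1), ‖g ((fun z ↦ q * z + c)^[j] z)‖ := by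
      rw [Finset.sum_range_succ _ (k + 1)]
      exact le_add_of_nonneg_right (norm_nonneg _)
    have h₃' : ∑ j ∈ Finset.range (k + 1), ‖g ((fun z ↦ q * z + c)^[j + 1] z)‖
        ≤ ∑ j ∈ Finset.range (k + 1 + 1), ‖g ((fun z ↦ q * z + c)^[j] z)‖ := by
      rw [Finset.sum_range_succ' _ (k + 1)]
      exact le_add_of_nonneg_right (norm_nonneg _)
    rw [Function.iterate_succ_apply' (hahnDifference q c)]
    set F := (hahnDifference q c)^[k] g
    set M := ∑ j ∈ Finset.range (k + 1 + 1), ‖g ((fun z ↦ q * z + c)^[j] z)‖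
    have hM : 0 ≤ M := Finset.sum_nonneg fun _ _ ↦ norm_nonneg _
    rw [hahnDifference, norm_div]
    calc _ ≤ (C * M + C * M) / δ := by
          gcongr
          exact (norm_sub_le _ _).trans (add_le_add (h₃.trans (by gcongr)) (h₂.trans (by gcongr)))
      _ = _ := by ring

theorem lemmal5p1 (g : ℂ → ℂ) (hg : Meromorphic g) (hnc : ¬ IsConstantMeromorphic g)
    (hfin : logarithmicOrder g < ⊤)
    (q c : ℂ) (hq : q ≠ 0) (hqc : q ≠ 1 ∨ c ≠ 0) (k : ℕ) (ε : ℝ) (hε : 0 < ε) :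
    (fun r : ℝ =>
        ValueDistribution.proximity (fun z => (hahnDifference q c)^[k] g z / g z) ⊤ r)
      =O[Filter.atTop]
    (fun r : ℝ => Real.log r ^ ((logarithmicOrder g).toReal - 1 + ε)) := by
  have hT := eventually_characteristic_le_log_rpow hfin hε
  rw [show (logarithmicOrder g).toReal - 1 + ε = (logarithmicOrder g).toReal + ε - 1 by ring]
  set τ := (logarithmicOrder g).toReal + ε
  obtain ⟨C, hC0, hC⟩ := exists_norm_iterate_hahnDifference_le g hq hqc k
  set ω : ℂ → ℂ := fun z ↦ q * z + c with hω
  -- The cost of moving `log⁺` through the factor `C` and a sum of `k + 1` terms.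
  set C' : ℝ := log⁺ C + log (k + 1) with hC'
  have hterm (j : ℕ) : (fun r ↦ proximity (fun z ↦ g (ω^[j] z) / g z) ⊤ r) =O[atTop]
      fun r ↦ log r ^ (τ - 1) := by
    obtain ⟨a, b, ha, hab⟩ := exists_iterate_affine_eq hq c j
    simp only [hω, hab]
    exact isBigO_proximity_comp_affine_div hg hnc hT ha b
  have hmer (j : ℕ) : Meromorphic (fun z ↦ g (ω^[j] z) / g z) := by
    obtain ⟨a, b, -, hab⟩ := exists_iterate_affine_eq hq c j
    simp only [hω, hab]
    exact (hg.comp_affine a b).div hg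
  have hconst : (fun _ : ℝ ↦ C') =O[atTop] fun r ↦ log r ^ (τ - 1) := by
    refine IsBigO.of_bound (|C'| * 2) ?_
    filter_upwards [eventually_one_le_two_mul_log_rpow hg hnc hT] with r hr
    rw [norm_eq_abs, norm_eq_abs, mul_assoc]
    refine le_mul_of_one_le_right (abs_nonneg _) (hr.trans ?_)
    gcongr
    exact le_abs_self _
  refine (IsBigO.of_bound' ?_).trans
    (hconst.add (IsBigO.sum fun j (_ : j ∈ Finset.range (k + 1)) ↦ hterm j))
  -- Turns the bound near infinity into one valid on whole circles of large radius.
  rw [← comap_norm_atTop, eventually_comap] at hC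
  filter_upwards [hC, eventually_gt_atTop 0] with r hr hr0
  rw [norm_of_nonneg (proximity_nonneg r)]
  refine le_trans ?_ (le_abs_self _)
  have hi (j : ℕ) : CircleIntegrable (fun z ↦ log⁺ ‖g (ω^[j] z) / g z‖) 0 r :=
    (hmer j).meromorphicOn.circleIntegrable_posLog_norm
  have hisum : CircleIntegrable
      (fun z ↦ ∑ j ∈ Finset.range (k + 1), log⁺ ‖g (ω^[j] z) / g z‖) 0 r :=
    CircleIntegrable.fun_sum _ fun j _ ↦ hi j
  simp only [proximity_top, Finset.sum_apply]
  rw [← circleAverage_fun_sum fun j _ ↦ hi j, ← circleAverage_const C' 0 r,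
    ← circleAverage_fun_add (circleIntegrable_const C' 0 r) hisum]
  refine circleAverage_mono
    ((hg.iterate_hahnDifference q c k).div hg).meromorphicOn.circleIntegrable_posLog_norm
    ((circleIntegrable_const C' 0 r).add hisum) fun z hz ↦ ?_
  rw [mem_sphere_zero_iff_norm, abs_of_pos hr0] at hz
  have hle : ‖(hahnDifference q c)^[k] g z / g z‖
      ≤ C * ∑ j ∈ Finset.range (k + 1), ‖g (ω^[j] z) / g z‖ := by
    simp only [norm_div]
    rw [← Finset.sum_div, ← mul_div_assoc]
    gcongr
    exact hr z hz
  calc _ ≤ log⁺ (C * ∑ j ∈ Finset.range (k + 1), ‖g (ω^[j] z) / g z‖) :=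
        posLog_le_posLog (norm_nonneg _) hle
    _ ≤ log⁺ C + (log (Finset.range (k + 1)).card
          + ∑ j ∈ Finset.range (k + 1), log⁺ ‖g (ω^[j] z) / g z‖) :=
        posLog_mul.trans (add_le_add le_rfl (posLog_sum _ _))
    _ = _ := by
        rw [hC', Finset.card_range]
        push_cast
        ring
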